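/- **Proposition.** For $a,b>0$ and $p\in\mathbb R$, let $\mathrm{GIG}_+(a,b,p)$ be the generalized inverse Gaussian distribution on $\mathbb R$, with density $$f_{+}(x;a,b,p)=\frac{(a/b)^{p/2}}{2K_p(\sqrt{ab})}\,x^{p-1}e^{-\frac12(ax+b/x)}\,\mathbf 1_{\{x>0\}},$$ where $K_p(z)=\int_0^\infty e^{-z\cosh t}\cosh(pt)\,dt$ $(z>0)$ is the modified Bessel function of the second kind, and let $\mathrm{GIG}_-(a,b,p)$ be its reflection, with density $f_-(x;a,b,p)=f_+(-x;a,b,p)$. Let $a_+,b_+,a_-,b_->0$ and $p_+,p_-\in\mathbb R$, and let $$\mathrm{BGIG}(a_+,b_+,p_+,a_-,b_-,p_-):=\mathrm{GIG}_+(a_+,b_+,p_+)\star\mathrm{GIG}_-(a_-,b_-,p_-)$$ be the bilateral generalized inverse Gaussian distribution. Let $$f(x)=\int_{\mathbb R} f_+(y;a_+,b_+,p_+)\,f_-(x-y;a_-,b_-,p_-)\,dy ,\qquad x\in\mathbb R .$$ Then $f$ is continuous and is a density of $\mathrm{BGIG}(a_+,b_+,p_+,a_-,b_-,p_-)$ with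 respect to Lebesgue measure, and 1. $f$ is not real-analytic at $0$; 2. $f$ is real-analytic at every point of $\mathbb R\setminus\{0\}$. -/

import Mathlib

open MeasureTheory

noncomputable section

/-- The modified Bessel function of the second kind `K_p(x)` for real order `p` and argument
`x > 0`, through the integral `K_p(x) = ∫₀^∞ exp(-x cosh t) cosh(p t) dt`
(absolutely convergent for every `x > 0`). -/
def besselK (p x : ℝ) : ℝ :=
  ∫ t in Set.Ioi (0 : ℝ), Real.exp (-x * Real.cosh t) * Real.cosh (p * t)

/-- The density of the generalized inverse Gaussian distribution `GIG₊(a, b, p)`, supported by the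
positive semi-axis. -/
def gigPosPDFReal (a b p x : ℝ) : ℝ :=
  if 0 < x then
    (a / b) ^ (p / 2) / (2 * besselK p (Real.sqrt (a * b))) * x ^ (p - 1)
      * Real.exp (-((a * x + b / x) / 2))
  else 0

/-- The density of the negative-sided generalized inverse Gaussian distribution `GIG₋(a, b, p)`,
supported by the negative semi-axis. -/
def gigNegPDFReal (a b p x : ℝ) : ℝ :=
  if x < 0 then
    (a / b) ^ (p / 2) / (2 * besselK p (Real.sqrt (a * b))) * |x| ^ (p - 1)
      * Real.exp (-((a * |x| + b / |x|) / 2))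
  else 0

/-- The distribution `GIG₊(a, b, p)`. -/
def gigPosMeasure (a b p : ℝ) : Measure ℝ :=
  volume.withDensity fun x => ENNReal.ofReal (gigPosPDFReal a b p x)

/-- The distribution `GIG₋(a, b, p)`. -/
def gigNegMeasure (a b p : ℝ) : Measure ℝ :=
  volume.withDensity fun x => ENNReal.ofReal (gigNegPDFReal a b p x)

/-- The bilateral generalized inverse Gaussian distribution: the convolution of
`GIG₊(a₊, b₊, p₊)` and `GIG₋(a₋, b₋, p₋)`. -/
def bgigMeasure (ap bp pp am bm pm : ℝ) : Measure ℝ :=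
  Measure.conv (gigPosMeasure ap bp pp) (gigNegMeasure am bm pm)

/-- The density function of the bilateral generalized inverse Gaussian distribution: the
convolution of the densities of `GIG₊(a₊, b₊, p₊)` and `GIG₋(a₋, b₋, p₋)`. -/
def bgigPDFReal (ap bp pp am bm pm x : ℝ) : ℝ :=
  ∫ y : ℝ, gigPosPDFReal ap bp pp y * gigNegPDFReal am bm pm (x - y)

end

/-!
Write `g` and `k` for the densities of `GIG₊(a₊, b₊, p₊)` and `GIG₊(a₋, b₋, p₋)`. After a
translation the bilateral density is `f x = ∫ g (x + u) k u du`, and reflecting `x` exchanges the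
two sets of parameters. Since `g` is bounded and continuous and `k` is integrable, `f` is
continuous.

*Analyticity off the origin.* On the right half-plane `g` extends holomorphically, with bounds that
are uniform on half-strips away from the imaginary axis, so `f` extends from the positive semi-axis
to a function `bgigExt` holomorphic on the right half-plane. The negative semi-axis follows by
reflection.

*Failure at the origin.* If `f` were analytic at `0`, the two extensions and the Taylor series at
`0` would glue to a holomorphic function on a horizontal strip, with exponential decay
(`AnalyticAt.exists_bgig_strip_extension`). Shifting the contour in `∫ f x exp (itx) dx` would make
the characteristic function of the bilateral distribution exponentially small as `t → ∞`
(`AnalyticAt.exists_norm_charFun_bgigMeasure_le`). That function is a product of characteristic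
functions of generalized inverse Gaussian laws, each of which, up to conjugation and a positive
constant, is a power of `A = a - 2it` times `K_p(√(bA))`. As `θ = |arg √(bA)| < π / 4`, Laplace's
method shows that it has the order of `exp (-√(b|A|) cos θ)` up to powers of `t`: a decay in `√t`
only (`tendsto_exp_mul_norm_charFun_gigPosMeasure`). The two facts contradict each other.
-/

open Filter Topology Set

/-! ### Holomorphic functions: contour shifts, parameter integrals, complexification -/

/-- Shifting the contour of integration from `ℝ` to `ℝ + ic`, by Cauchy's theorem on the rectangles
`[-T, T] × [0, c]`, whose vertical sides contribute nothing in the limit. -/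
theorem integral_eq_integral_add_mul_I_of_bound {F : ℂ → ℂ} {B : ℝ → ℝ} {c : ℝ} (hc : 0 ≤ c)
    (hF : ∀ z : ℂ, z.im ∈ Icc 0 c → DifferentiableAt ℂ F z)
    (hB : ∀ x : ℝ, ∀ y ∈ Icc 0 c, ‖F (x + y * Complex.I)‖ ≤ B x)
    (hBi : Integrable B) (hBtop : Tendsto B atTop (𝓝 0)) (hBbot : Tendsto B atBot (𝓝 0)) :
    ∫ x : ℝ, F x = ∫ x : ℝ, F (x + c * Complex.I) := by
  have hint : ∀ y ∈ Icc 0 c, Integrable fun x : ℝ => F (x + y * Complex.I) := by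
    intro y hy
    refine hBi.mono' (Continuous.aestronglyMeasurable ?_) (ae_of_all _ fun x => hB x y hy)
    refine continuous_iff_continuousAt.2 fun x => ?_
    exact ContinuousAt.comp (f := fun x : ℝ => (x + y * Complex.I : ℂ))
      (hF _ (by simpa using hy)).continuousAt (by fun_prop)
  have h0 : (0 : ℝ) ∈ Icc 0 c := ⟨le_rfl, hc⟩
  have hc' : c ∈ Icc 0 c := ⟨hc, le_rfl⟩
  have hlim0 := intervalIntegral_tendsto_integral (hint 0 h0) tendsto_neg_atTop_atBot tendsto_id
  have hlimc := intervalIntegral_tendsto_integral (hint c hc') tendsto_neg_atTop_atBot tendsto_id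
  have hside : ∀ s : ℝ → ℝ, Tendsto (fun T => B (s T)) atTop (𝓝 0) →
      Tendsto (fun T => Complex.I • ∫ y in (0 : ℝ)..c, F (s T + y * Complex.I)) atTop (𝓝 0) := by
    intro s hs
    refine squeeze_zero_norm (a := fun T => B (s T) * |c - 0|) (fun T => ?_)
      (by simpa using hs.mul_const |c - 0|)
    rw [norm_smul, Complex.norm_I, one_mul]
    refine intervalIntegral.norm_integral_le_of_norm_le_const fun y hy => hB _ _ ?_
    rw [uIoc_of_le hc] at hy
    exact ⟨hy.1.le, hy.2⟩
  have hrect : ∀ T : ℝ, (∫ x in -T..T, F (x + (0 : ℝ) * Complex.I))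
      - (∫ x in -T..T, F (x + c * Complex.I))
      + Complex.I • (∫ y in (0 : ℝ)..c, F (T + y * Complex.I))
      - Complex.I • (∫ y in (0 : ℝ)..c, F ((-T : ℝ) + y * Complex.I)) = 0 := by
    intro T
    have := Complex.integral_boundary_rect_eq_zero_of_differentiableOn F
      ⟨-T, 0⟩ ⟨T, c⟩ (fun z hz => (hF z (by
        have := hz.2; rw [mem_preimage, uIcc_of_le hc] at this; exact this)).differentiableWithinAt)
    simpa using this
  have hsum := ((hlim0.sub hlimc).add (hside id hBtop)).sub
    (hside (fun T => -T) (hBbot.comp tendsto_neg_atTop_atBot))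
  have h := tendsto_nhds_unique hsum (tendsto_const_nhds.congr fun T => (hrect T).symm)
  simp only [add_zero, sub_zero] at h
  have := sub_eq_zero.1 h
  simpa using this

/-- An integral of functions holomorphic in a parameter and locally dominated is holomorphic; the
domination of the derivative comes from Cauchy's estimate. -/
theorem differentiableAt_integral_of_dominated {f : ℂ → ℝ → ℂ} {B : ℝ → ℝ} {z₀ : ℂ} {r : ℝ}
    (hr : 0 < r) (hm : ∀ z ∈ Metric.ball z₀ r, AEStronglyMeasurable (f z))
    (hf : ∀ u, DifferentiableOn ℂ (fun z => f z u) (Metric.ball z₀ r))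
    (hB : ∀ z ∈ Metric.ball z₀ r, ∀ u, ‖f z u‖ ≤ B u) (hBi : Integrable B) :
    DifferentiableAt ℂ (fun z => ∫ u, f z u) z₀ := by
  have hz₀ : z₀ ∈ Metric.ball z₀ r := Metric.mem_ball_self hr
  have hd : ∀ u, ∀ z ∈ Metric.ball z₀ r, DifferentiableAt ℂ (fun z => f z u) z := fun u z hz =>
    (hf u).differentiableAt (Metric.isOpen_ball.mem_nhds hz)
  have hsub : ∀ z ∈ Metric.ball z₀ (r / 2), Metric.closedBall z (r / 4) ⊆ Metric.ball z₀ r := by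
    intro z hz
    refine Metric.closedBall_subset_ball' ?_
    have := Metric.mem_ball.1 hz
    linarith
  refine (hasDerivAt_integral_of_dominated_loc_of_deriv_le
    (F' := fun z u => deriv (fun z => f z u) z) (bound := fun u => B u / (r / 4))
    (Metric.ball_mem_nhds z₀ (half_pos hr))
    (eventually_of_mem (Metric.ball_mem_nhds z₀ hr) hm)
    (hBi.mono' (hm z₀ hz₀) (ae_of_all _ (hB z₀ hz₀))) ?_ ?_ (hBi.div_const _) ?_).2.differentiableAt
  · -- the derivative is a pointwise limit of difference quotients
    obtain ⟨N, hN⟩ := exists_nat_gt (1 / r)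
    have hpos : ∀ n : ℕ, 0 < ((n + N + 1 : ℕ) : ℝ) := fun n => by positivity
    have hmem : ∀ n : ℕ, z₀ + ((((n + N + 1 : ℕ) : ℝ)⁻¹ : ℝ) : ℂ) ∈ Metric.ball z₀ r := by
      intro n
      rw [Metric.mem_ball, dist_eq_norm, add_sub_cancel_left, Complex.norm_real,
        Real.norm_of_nonneg (inv_nonneg.2 (hpos n).le)]
      refine inv_lt_of_inv_lt₀ hr (lt_of_lt_of_le ?_ (Nat.cast_le.2 (by lia : N ≤ n + N + 1)))
      simpa using hN
    have hlim0 : Tendsto (fun n : ℕ => ((((n + N + 1 : ℕ) : ℝ)⁻¹ : ℝ) : ℂ)) atTop (𝓝[≠] 0) := by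
      refine tendsto_nhdsWithin_iff.2 ⟨?_, Eventually.of_forall fun n => ?_⟩
      · have : Tendsto (fun n : ℕ => (((n + N + 1 : ℕ) : ℝ)⁻¹)) atTop (𝓝 0) := by
          have h := tendsto_inv_atTop_nhds_zero_nat (𝕜 := ℝ)
          exact (tendsto_add_atTop_iff_nat (N + 1)).2 h
        have h := (Complex.continuous_ofReal.tendsto 0).comp this
        rwa [Complex.ofReal_zero] at h
      · have := hpos n
        simp only [mem_compl_iff, mem_singleton_iff, Complex.ofReal_eq_zero, inv_eq_zero]
        exact this.ne'
    refine aestronglyMeasurable_of_tendsto_ae atTop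
      (f := fun (n : ℕ) u => ((((n + N + 1 : ℕ) : ℝ)⁻¹ : ℝ) : ℂ)⁻¹ •
        (f (z₀ + ((((n + N + 1 : ℕ) : ℝ)⁻¹ : ℝ) : ℂ)) u - f z₀ u))
      (fun n => ((hm _ (hmem n)).sub (hm z₀ hz₀)).const_smul ((((n + N + 1 : ℕ) : ℝ)⁻¹ : ℝ) : ℂ)⁻¹)
      (ae_of_all _ fun u => ?_)
    exact ((hasDerivAt_iff_tendsto_slope_zero.1 (hd u z₀ hz₀).hasDerivAt).comp hlim0)
  · refine ae_of_all _ fun u z hz => ?_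
    refine Complex.norm_deriv_le_of_forall_mem_sphere_norm_le (by positivity) ?_
      (fun w hw => hB w (hsub z hz (Metric.sphere_subset_closedBall hw)) u)
    exact ((hf u).mono (hsub z hz)).diffContOnCl_ball subset_rfl
  · exact ae_of_all _ fun u z hz =>
      (hd u z (Metric.ball_subset_ball (by linarith) hz)).hasDerivAt

/-- A function that is real-analytic at `0` is, near `0`, the restriction of a holomorphic
function, namely of the sum of its Taylor series in the complex domain. -/
theorem AnalyticAt.exists_complexification {f : ℝ → ℝ} (hf : AnalyticAt ℝ f 0) :
    ∃ r > 0, ∃ G : ℂ → ℂ, DifferentiableOn ℂ G (Metric.ball 0 r) ∧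
      ∀ x : ℝ, |x| < r → G x = f x := by
  obtain ⟨p, R, hp⟩ := hf
  let q : FormalMultilinearSeries ℂ ℂ ℂ :=
    FormalMultilinearSeries.ofScalars ℂ fun n => (p.coeff n : ℂ)
  have hq : R ≤ q.radius := by
    refine hp.r_le.trans (ENNReal.le_of_forall_nnreal_lt fun s hs => ?_)
    obtain ⟨C, -, hC⟩ := p.norm_mul_pow_le_of_lt_radius hs
    refine q.le_radius_of_bound C fun n => ?_
    have : ‖q n‖ = ‖p n‖ := by
      rw [FormalMultilinearSeries.ofScalars_norm, Complex.norm_real,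
        FormalMultilinearSeries.norm_apply_eq_norm_coef]
    rw [this]
    exact hC n
  obtain ⟨r, hr0, hrR⟩ := ENNReal.lt_iff_exists_nnreal_btwn.1 hp.r_pos
  have hr : 0 < (r : ℝ) := by exact_mod_cast hr0
  have hball := q.hasFPowerSeriesOnBall ((hr0.trans hrR).trans_le hq)
  refine ⟨r, hr, q.sum, fun z hz => ?_, fun x hx => ?_⟩
  · refine (hball.differentiableOn.differentiableAt ?_).differentiableWithinAt
    refine Metric.isOpen_eball.mem_nhds ?_
    refine Metric.eball_subset_eball (hrR.le.trans hq) ?_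
    rw [Metric.eball_coe]
    exact hz
  · have hx' : x ∈ Metric.eball (0 : ℝ) R := by
      refine Metric.eball_subset_eball hrR.le ?_
      rw [Metric.eball_coe]
      simpa using hx
    have h1 := hp.hasSum hx'
    rw [zero_add] at h1
    rw [FormalMultilinearSeries.sum]
    have h2 := (Complex.hasSum_ofReal.2 h1).tsum_eq
    rw [← h2]
    refine tsum_congr fun n => ?_
    rw [FormalMultilinearSeries.apply_eq_pow_smul_coeff,
      FormalMultilinearSeries.apply_eq_pow_smul_coeff]
    simp [q, FormalMultilinearSeries.coeff_ofScalars]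

/-! ### Gaussian domination -/

theorem Real.one_add_sq_div_two_le_cosh (x : ℝ) : 1 + x ^ 2 / 2 ≤ Real.cosh x := by
  have h : Real.cosh x = 1 + 2 * Real.sinh (x / 2) ^ 2 := by
    have h1 := Real.cosh_two_mul (x / 2)
    rw [mul_div_cancel₀ x two_ne_zero, Real.cosh_sq] at h1
    rw [h1]; ring
  have h2 : (x / 2) ^ 2 ≤ Real.sinh (x / 2) ^ 2 := by
    rw [sq_le_sq, Real.abs_sinh]
    exact Real.self_le_sinh_iff.2 (abs_nonneg _)
  rw [h]
  nlinarith

theorem integrable_exp_mul_sub_mul_sq (p : ℝ) {δ : ℝ} (hδ : 0 < δ) :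
    Integrable fun x : ℝ => Real.exp (p * x - δ * x ^ 2) := by
  have h := (integrable_cexp_quadratic (b := δ) (by simpa using hδ) p 0).norm
  refine h.congr (ae_of_all _ fun x => ?_)
  simp only [Complex.norm_exp]
  congr 1
  simp [← Complex.ofReal_pow]
  ring

theorem tendsto_exp_mul_sub_mul_sq_atTop (p : ℝ) {δ : ℝ} (hδ : 0 < δ) :
    Tendsto (fun x : ℝ => Real.exp (p * x - δ * x ^ 2)) atTop (𝓝 0) := by
  refine Real.tendsto_exp_atBot.comp ?_
  have h : Tendsto (fun x : ℝ => x * (p - δ * x)) atTop atBot := by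
    refine tendsto_id.atTop_mul_atBot₀ ?_
    refine tendsto_atBot_add_const_left _ p ?_ |>.congr (fun x => (sub_eq_add_neg _ _).symm)
    exact tendsto_neg_atTop_atBot.comp (tendsto_id.const_mul_atTop hδ)
  exact h.congr fun x => by ring

theorem tendsto_exp_mul_sub_mul_sq_atBot (p : ℝ) {δ : ℝ} (hδ : 0 < δ) :
    Tendsto (fun x : ℝ => Real.exp (p * x - δ * x ^ 2)) atBot (𝓝 0) := by
  refine ((tendsto_exp_mul_sub_mul_sq_atTop (-p) hδ).comp tendsto_neg_atBot_atTop).congr fun x => ?_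
  simp

/-! ### The generalized inverse Gaussian density -/

theorem integrable_exp_mul_sub_mul_cosh (p : ℝ) {x : ℝ} (hx : 0 < x) :
    Integrable fun t : ℝ => Real.exp (p * t - x * Real.cosh t) := by
  refine (integrable_exp_mul_sub_mul_sq p (half_pos hx)).mono'
    (by fun_prop) (ae_of_all _ fun t => ?_)
  rw [Real.norm_of_nonneg (Real.exp_pos _).le]
  refine Real.exp_le_exp.2 ?_
  nlinarith [Real.one_add_sq_div_two_le_cosh t]

/-- In particular the normalizing constant of the density is not a division by zero. -/
theorem besselK_pos (p : ℝ) {x : ℝ} (hx : 0 < x) : 0 < besselK p x := by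
  have hpos : ∀ t : ℝ, 0 < Real.exp (-x * Real.cosh t) * Real.cosh (p * t) := fun t =>
    mul_pos (Real.exp_pos _) (Real.cosh_pos _)
  have hint : Integrable fun t : ℝ => Real.exp (-x * Real.cosh t) * Real.cosh (p * t) := by
    refine (((integrable_exp_mul_sub_mul_cosh p hx).add
      (integrable_exp_mul_sub_mul_cosh (-p) hx)).div_const 2).congr (ae_of_all _ fun t => ?_)
    simp only [Pi.add_apply, Real.cosh_eq (p * t), sub_eq_add_neg, Real.exp_add, neg_mul]
    ring
  rw [besselK, setIntegral_pos_iff_support_of_nonneg_ae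
    (ae_of_all _ fun t => (hpos t).le) hint.integrableOn]
  rw [Function.support_eq_univ fun t => (hpos t).ne', univ_inter, Real.volume_Ioi]
  exact ENNReal.zero_lt_top

/-- The normalizing constant of the generalized inverse Gaussian distribution. -/
noncomputable def gigConst (a b p : ℝ) : ℝ :=
  (a / b) ^ (p / 2) / (2 * besselK p (Real.sqrt (a * b)))

theorem gigConst_pos {a b : ℝ} (p : ℝ) (ha : 0 < a) (hb : 0 < b) : 0 < gigConst a b p := by
  have := besselK_pos p (Real.sqrt_pos.2 (mul_pos ha hb))
  unfold gigConst
  positivity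

theorem gigPosPDFReal_of_pos (a b p : ℝ) {x : ℝ} (hx : 0 < x) :
    gigPosPDFReal a b p x =
      gigConst a b p * x ^ (p - 1) * Real.exp (-((a * x + b / x) / 2)) := by
  simp [gigPosPDFReal, gigConst, hx]

theorem gigPosPDFReal_of_nonpos (a b p : ℝ) {x : ℝ} (hx : x ≤ 0) : gigPosPDFReal a b p x = 0 := by
  simp [gigPosPDFReal, hx.not_gt]

theorem gigNegPDFReal_eq (a b p x : ℝ) : gigNegPDFReal a b p x = gigPosPDFReal a b p (-x) := by
  simp only [gigNegPDFReal, gigPosPDFReal, Left.neg_pos_iff]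
  split_ifs with h
  · rw [abs_of_neg h]
  · rfl

theorem gigPosPDFReal_nonneg {a b : ℝ} (p : ℝ) (ha : 0 < a) (hb : 0 < b) (x : ℝ) :
    0 ≤ gigPosPDFReal a b p x := by
  rcases lt_or_ge 0 x with hx | hx
  · rw [gigPosPDFReal_of_pos a b p hx]
    have := gigConst_pos p ha hb
    positivity
  · rw [gigPosPDFReal_of_nonpos a b p hx]

/-- The factor `exp (-b / (2 x))` makes the density flat at the origin, whatever the power of `x`
it is multiplied by. -/
theorem continuous_gigPosPDFReal {a b : ℝ} (p : ℝ) (ha : 0 < a) (hb : 0 < b) :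
    Continuous (gigPosPDFReal a b p) := by
  refine continuous_iff_continuousAt.2 fun x => ?_
  rcases lt_trichotomy x 0 with hx | rfl | hx
  · refine continuousAt_const.congr (f := fun _ => (0 : ℝ)) ?_
    filter_upwards [Iio_mem_nhds hx] with y hy
    exact (gigPosPDFReal_of_nonpos a b p (le_of_lt hy)).symm
  · have hleft : Tendsto (gigPosPDFReal a b p) (𝓝[≤] 0) (𝓝 0) := by
      refine tendsto_const_nhds.congr' ?_
      filter_upwards [self_mem_nhdsWithin] with y hy
      exact (gigPosPDFReal_of_nonpos a b p hy).symm
    have hright : Tendsto (gigPosPDFReal a b p) (𝓝[>] 0) (𝓝 0) := by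
      have h1 := ((tendsto_rpow_mul_exp_neg_mul_atTop_nhds_zero (1 - p) (b / 2)
        (half_pos hb)).comp (tendsto_inv_nhdsGT_zero (𝕜 := ℝ))).const_mul (gigConst a b p)
      rw [mul_zero] at h1
      refine squeeze_zero' (Eventually.of_forall (gigPosPDFReal_nonneg p ha hb)) ?_ h1
      filter_upwards [self_mem_nhdsWithin] with y hy
      have hy : 0 < y := hy
      rw [gigPosPDFReal_of_pos a b p hy, mul_assoc]
      refine mul_le_mul_of_nonneg_left ?_ (gigConst_pos p ha hb).le
      have h2 : y⁻¹ ^ (1 - p) = y ^ (p - 1) := by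
        rw [Real.inv_rpow hy.le, ← Real.rpow_neg hy.le, neg_sub]
      simp only [Function.comp_apply, h2]
      refine mul_le_mul_of_nonneg_left (Real.exp_le_exp.2 ?_) (by positivity)
      have : 0 < a * y := mul_pos ha hy
      rw [div_eq_mul_inv b y]
      linarith
    have h0 : gigPosPDFReal a b p 0 = 0 := gigPosPDFReal_of_nonpos a b p le_rfl
    have h := hleft.sup hright
    rw [nhdsLE_sup_nhdsGT] at h
    rwa [ContinuousAt, h0]
  · have h : ContinuousAt
        (fun y => gigConst a b p * y ^ (p - 1) * Real.exp (-((a * y + b / y) / 2))) x := by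
      have := hx.ne'
      fun_prop (disch := simp [*])
    refine h.congr ?_
    filter_upwards [Ioi_mem_nhds hx] with y hy
    exact (gigPosPDFReal_of_pos a b p hy).symm

theorem ContinuousOn.exists_bound_of_tendsto_atTop {h : ℝ → ℝ} {r : ℝ}
    (hc : ContinuousOn h (Ici r)) (ht : Tendsto h atTop (𝓝 0)) :
    ∃ K > 0, ∀ x, r ≤ x → h x ≤ K := by
  obtain ⟨N, hN⟩ := eventually_atTop.1 (ht.eventually_le_const one_pos)
  obtain ⟨C, hC⟩ := (isCompact_Icc (a := r) (b := N)).exists_bound_of_continuousOn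
    (hc.mono Icc_subset_Ici_self)
  refine ⟨max C 1, by positivity, fun x hx => ?_⟩
  rcases le_total x N with h1 | h1
  · exact (le_abs_self _).trans ((hC x ⟨hx, h1⟩).trans (le_max_left _ _))
  · exact (hN x h1).trans (le_max_right _ _)

theorem exists_gigPosPDFReal_le {a b : ℝ} (p : ℝ) (ha : 0 < a) (hb : 0 < b) :
    ∃ K > 0, ∀ x, 0 ≤ x → gigPosPDFReal a b p x ≤ K * Real.exp (-(a / 4) * x) := by
  obtain ⟨K, hK, h⟩ := ContinuousOn.exists_bound_of_tendsto_atTop (r := 0)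
    (h := fun x => gigPosPDFReal a b p x * Real.exp (a / 4 * x))
    ((continuous_gigPosPDFReal p ha hb).mul (by fun_prop)).continuousOn (by
      have h1 := (tendsto_rpow_mul_exp_neg_mul_atTop_nhds_zero (p - 1) (a / 4)
        (by positivity)).const_mul (gigConst a b p)
      rw [mul_zero] at h1
      refine squeeze_zero' (Eventually.of_forall fun x =>
        mul_nonneg (gigPosPDFReal_nonneg p ha hb x) (Real.exp_pos _).le) ?_ h1
      filter_upwards [eventually_gt_atTop 0] with x hx
      have := gigConst_pos p ha hb
      rw [gigPosPDFReal_of_pos a b p hx, mul_assoc, mul_assoc, ← Real.exp_add]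
      gcongr
      have : 0 < b / x := div_pos hb hx
      linarith)
  refine ⟨K, hK, fun x hx => ?_⟩
  rw [neg_mul, Real.exp_neg, ← div_eq_mul_inv, le_div_iff₀ (Real.exp_pos _)]
  exact h x hx

theorem exists_gigPosPDFReal_le_const {a b : ℝ} (p : ℝ) (ha : 0 < a) (hb : 0 < b) :
    ∃ K > 0, ∀ x, gigPosPDFReal a b p x ≤ K := by
  obtain ⟨K, hK, h⟩ := exists_gigPosPDFReal_le p ha hb
  refine ⟨K, hK, fun x => ?_⟩
  rcases le_total 0 x with hx | hx
  · refine (h x hx).trans (mul_le_of_le_one_right hK.le (Real.exp_le_one_iff.2 ?_))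
    nlinarith
  · rw [gigPosPDFReal_of_nonpos a b p hx]
    exact hK.le

theorem integrable_gigPosPDFReal {a b : ℝ} (p : ℝ) (ha : 0 < a) (hb : 0 < b) :
    Integrable (gigPosPDFReal a b p) := by
  obtain ⟨K, hK, h⟩ := exists_gigPosPDFReal_le p ha hb
  have hon : IntegrableOn (gigPosPDFReal a b p) (Ioi 0) := by
    refine Integrable.mono' ((exp_neg_integrableOn_Ioi 0 (b := a / 4) (by positivity)).const_mul K)
      (continuous_gigPosPDFReal p ha hb).aestronglyMeasurable ?_
    filter_upwards [ae_restrict_mem measurableSet_Ioi] with x hx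
    rw [Real.norm_of_nonneg (gigPosPDFReal_nonneg p ha hb x)]
    exact h x (le_of_lt hx)
  exact (integrableOn_iff_integrable_of_support_subset fun x hx => by
    by_contra h0
    exact hx (gigPosPDFReal_of_nonpos a b p (not_lt.1 h0))).1 hon

/-! ### The convolution of the two densities -/

theorem bgigPDFReal_eq_integral_add (ap bp pp am bm pm x : ℝ) :
    bgigPDFReal ap bp pp am bm pm x =
      ∫ u, gigPosPDFReal ap bp pp (x + u) * gigPosPDFReal am bm pm u := by
  rw [bgigPDFReal, ← integral_add_left_eq_self _ x]
  simp [gigNegPDFReal_eq]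

theorem bgigPDFReal_neg (ap bp pp am bm pm x : ℝ) :
    bgigPDFReal ap bp pp am bm pm (-x) = bgigPDFReal am bm pm ap bp pp x := by
  rw [bgigPDFReal_eq_integral_add, bgigPDFReal_eq_integral_add, ← integral_add_left_eq_self _ x]
  simp [mul_comm]

theorem bgigPDFReal_nonneg {ap bp am bm : ℝ} (pp pm : ℝ) (hap : 0 < ap) (hbp : 0 < bp)
    (ham : 0 < am) (hbm : 0 < bm) (x : ℝ) : 0 ≤ bgigPDFReal ap bp pp am bm pm x := by
  rw [bgigPDFReal_eq_integral_add]
  exact integral_nonneg fun u =>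
    mul_nonneg (gigPosPDFReal_nonneg pp hap hbp _) (gigPosPDFReal_nonneg pm ham hbm _)

theorem continuous_bgigPDFReal {ap bp am bm : ℝ} (pp pm : ℝ) (hap : 0 < ap) (hbp : 0 < bp)
    (ham : 0 < am) (hbm : 0 < bm) : Continuous (bgigPDFReal ap bp pp am bm pm) := by
  obtain ⟨K, -, hK⟩ := exists_gigPosPDFReal_le_const pp hap hbp
  have hcp := continuous_gigPosPDFReal pp hap hbp
  have hcm := continuous_gigPosPDFReal pm ham hbm
  have h : Continuous fun x =>
      ∫ u, gigPosPDFReal ap bp pp (x + u) * gigPosPDFReal am bm pm u := by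
    refine continuous_of_dominated (bound := fun u => K * gigPosPDFReal am bm pm u)
      (fun x => by fun_prop) (fun x => ae_of_all _ fun u => ?_)
      ((integrable_gigPosPDFReal pm ham hbm).const_mul K) (ae_of_all _ fun u => by fun_prop)
    have h1 := gigPosPDFReal_nonneg pp hap hbp (x + u)
    have h2 := gigPosPDFReal_nonneg pm ham hbm u
    rw [Real.norm_of_nonneg (mul_nonneg h1 h2)]
    exact mul_le_mul_of_nonneg_right (hK _) h2
  exact h.congr fun x => (bgigPDFReal_eq_integral_add ap bp pp am bm pm x).symm

theorem bgigMeasure_eq_withDensity {ap bp am bm : ℝ} (pp pm : ℝ) (hap : 0 < ap) (hbp : 0 < bp)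
    (ham : 0 < am) (hbm : 0 < bm) :
    bgigMeasure ap bp pp am bm pm =
      volume.withDensity fun x => ENNReal.ofReal (bgigPDFReal ap bp pp am bm pm x) := by
  have hcp := continuous_gigPosPDFReal pp hap hbp
  have hcm := continuous_gigPosPDFReal pm ham hbm
  obtain ⟨K, -, hK⟩ := exists_gigPosPDFReal_le_const pm ham hbm
  rw [bgigMeasure, gigPosMeasure, gigNegMeasure]
  simp only [gigNegPDFReal_eq]
  rw [conv_withDensity_eq_lconvolution (by fun_prop) (by fun_prop)]
  congr 1
  funext x
  have hnn : ∀ y, 0 ≤ gigPosPDFReal ap bp pp y * gigPosPDFReal am bm pm (-(x - y)) := fun y =>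
    mul_nonneg (gigPosPDFReal_nonneg pp hap hbp _) (gigPosPDFReal_nonneg pm ham hbm _)
  rw [lconvolution_def, bgigPDFReal]
  simp only [gigNegPDFReal_eq]
  rw [ofReal_integral_eq_lintegral_ofReal ?_ (ae_of_all _ hnn)]
  · refine lintegral_congr fun y => ?_
    rw [ENNReal.ofReal_mul (gigPosPDFReal_nonneg pp hap hbp _)]
    congr 4
    ring
  · refine ((integrable_gigPosPDFReal pp hap hbp).mul_const K).mono' (by fun_prop)
      (ae_of_all _ fun y => ?_)
    rw [Real.norm_of_nonneg (hnn y)]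
    exact mul_le_mul_of_nonneg_left (hK _) (gigPosPDFReal_nonneg pp hap hbp _)

/-! ### Holomorphic extension to the right half-plane -/

/-- The holomorphic extension of the density of `GIG₊(a, b, p)` from the positive semi-axis to the
right half-plane, with the principal branch of the power. -/
noncomputable def gigPosExt (a b p : ℝ) (w : ℂ) : ℂ :=
  gigConst a b p * w ^ ((p : ℂ) - 1) * Complex.exp (-((a * w + b / w) / 2))

theorem gigPosExt_ofReal (a b p : ℝ) {x : ℝ} (hx : 0 < x) :
    gigPosExt a b p x = gigPosPDFReal a b p x := by
  rw [gigPosExt, gigPosPDFReal_of_pos a b p hx]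
  push_cast [Complex.ofReal_cpow hx.le]
  rfl

theorem differentiableAt_gigPosExt (a b p : ℝ) {w : ℂ} (hw : 0 < w.re) :
    DifferentiableAt ℂ (gigPosExt a b p) w := by
  have h0 : w ≠ 0 := by
    rintro rfl
    simp at hw
  have hs : w ∈ Complex.slitPlane := Or.inl hw
  unfold gigPosExt
  fun_prop (disch := assumption)

theorem measurable_gigPosExt (a b p : ℝ) : Measurable (gigPosExt a b p) := by
  unfold gigPosExt
  fun_prop

/-- For `0 < re w` the real part of `b / w` is nonnegative, so the essential singularity at the
origin does no harm; half of the factor `exp (-a w / 2)` absorbs the power of `w`. -/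
theorem exists_norm_gigPosExt_le {a b : ℝ} (p : ℝ) (ha : 0 < a) (hb : 0 < b) {r : ℝ} (hr : 0 < r)
    (M : ℝ) : ∃ K > 0, ∀ w : ℂ, r ≤ w.re → |w.im| ≤ M →
      ‖gigPosExt a b p w‖ ≤ K * Real.exp (-(a / 4) * w.re) := by
  obtain ⟨K, hK, h⟩ := ContinuousOn.exists_bound_of_tendsto_atTop (r := r)
    (h := fun s => s ^ (p - 1) * Real.exp (-(a / 4) * s))
    (fun s hs => by
      have : s ≠ 0 := (hr.trans_le hs).ne'
      exact ContinuousAt.continuousWithinAt (by fun_prop (disch := simp [*])))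
    (tendsto_rpow_mul_exp_neg_mul_atTop_nhds_zero (p - 1) (a / 4) (by positivity))
  have hc := gigConst_pos p ha hb
  refine ⟨gigConst a b p * K * Real.exp (a / 4 * M), by positivity, fun w hw hM => ?_⟩
  have hre : 0 < w.re := hr.trans_le hw
  have h0 : w ≠ 0 := by
    rintro rfl
    simp at hre
  have hpow : ‖w ^ ((p : ℂ) - 1)‖ = ‖w‖ ^ (p - 1) := by
    rw [Complex.norm_cpow_of_ne_zero h0]
    simp
  have hsb : ‖w‖ ≤ w.re + M := by
    have := Complex.norm_le_abs_re_add_abs_im w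
    rw [abs_of_pos hre] at this
    linarith
  have hk := h ‖w‖ (hw.trans (Complex.re_le_norm w))
  rw [neg_mul, Real.exp_neg, ← div_eq_mul_inv, div_le_iff₀ (Real.exp_pos _)] at hk
  have hdiv : 0 ≤ ((b : ℂ) / w).re := by
    rw [Complex.div_re]
    simp only [Complex.ofReal_re, Complex.ofReal_im, zero_mul, zero_div, add_zero]
    have := Complex.normSq_pos.2 h0
    positivity
  have hexp : ‖Complex.exp (-((a * w + b / w) / 2))‖ ≤ Real.exp (-(a / 2) * w.re) := by
    rw [Complex.norm_exp]
    refine Real.exp_le_exp.2 ?_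
    have : (-((a * w + b / w) / 2) : ℂ).re = -((a * w.re + (b / w : ℂ).re) / 2) := by simp
    rw [this]
    linarith
  rw [gigPosExt, norm_mul, norm_mul, hpow, Complex.norm_real, Real.norm_of_nonneg hc.le]
  calc gigConst a b p * ‖w‖ ^ (p - 1) * ‖Complex.exp (-((a * w + b / w) / 2))‖
      ≤ gigConst a b p * (K * Real.exp (a / 4 * (w.re + M))) * Real.exp (-(a / 2) * w.re) := by
        gcongr
        refine hk.trans ?_
        gcongr
    _ = gigConst a b p * K * Real.exp (a / 4 * M) * Real.exp (-(a / 4) * w.re) := by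
        have : -(a / 4) * w.re = a / 4 * w.re + -(a / 2) * w.re := by ring
        rw [this, mul_add, Real.exp_add, Real.exp_add]
        ring

/-- The holomorphic extension of the bilateral density from the positive semi-axis to the right
half-plane. -/
noncomputable def bgigExt (ap bp pp am bm pm : ℝ) (z : ℂ) : ℂ :=
  ∫ u : ℝ, gigPosExt ap bp pp (z + u) * gigPosPDFReal am bm pm u

theorem bgigExt_ofReal (ap bp pp am bm pm : ℝ) {x : ℝ} (hx : 0 < x) :
    bgigExt ap bp pp am bm pm x = bgigPDFReal ap bp pp am bm pm x := by
  rw [bgigExt, bgigPDFReal_eq_integral_add, ← integral_complex_ofReal]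
  refine integral_congr_ae (ae_of_all _ fun u => ?_)
  rcases lt_or_ge 0 u with hu | hu
  · beta_reduce
    rw [← Complex.ofReal_add, gigPosExt_ofReal ap bp pp (add_pos hx hu)]
    push_cast
    rfl
  · simp [gigPosPDFReal_of_nonpos am bm pm hu]

theorem exists_norm_gigPosExt_mul_le {ap bp am bm : ℝ} (pp pm : ℝ) (hap : 0 < ap) (hbp : 0 < bp)
    (ham : 0 < am) (hbm : 0 < bm) {r : ℝ} (hr : 0 < r) (M : ℝ) :
    ∃ K > 0, ∀ z : ℂ, r ≤ z.re → |z.im| ≤ M → ∀ u : ℝ,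
      ‖gigPosExt ap bp pp (z + u) * gigPosPDFReal am bm pm u‖ ≤
        K * Real.exp (-(ap / 4) * z.re) * gigPosPDFReal am bm pm u := by
  obtain ⟨K, hK, h⟩ := exists_norm_gigPosExt_le pp hap hbp hr M
  refine ⟨K, hK, fun z hz hM u => ?_⟩
  rcases lt_or_ge 0 u with hu | hu
  · have h0 := gigPosPDFReal_nonneg pm ham hbm u
    rw [norm_mul, Complex.norm_real, Real.norm_of_nonneg h0]
    refine mul_le_mul_of_nonneg_right ((h (z + u) ?_ ?_).trans ?_) h0
    · simp only [Complex.add_re, Complex.ofReal_re]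
      linarith
    · simpa using hM
    · refine mul_le_mul_of_nonneg_left (Real.exp_le_exp.2 ?_) hK.le
      simp only [Complex.add_re, Complex.ofReal_re]
      nlinarith
  · simp [gigPosPDFReal_of_nonpos am bm pm hu]

theorem differentiableAt_bgigExt {ap bp am bm : ℝ} (pp pm : ℝ) (hap : 0 < ap) (hbp : 0 < bp)
    (ham : 0 < am) (hbm : 0 < bm) {z : ℂ} (hz : 0 < z.re) :
    DifferentiableAt ℂ (bgigExt ap bp pp am bm pm) z := by
  obtain ⟨K, hK, h⟩ := exists_norm_gigPosExt_mul_le pp pm hap hbp ham hbm (half_pos hz)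
    (|z.im| + z.re / 2)
  have hball : ∀ w ∈ Metric.ball z (z.re / 2), z.re / 2 ≤ w.re ∧ |w.im| ≤ |z.im| + z.re / 2 := by
    intro w hw
    rw [Metric.mem_ball, dist_eq_norm] at hw
    have h1 := (Complex.abs_re_le_norm (w - z)).trans hw.le
    have h2 := (Complex.abs_im_le_norm (w - z)).trans hw.le
    rw [Complex.sub_re] at h1
    rw [Complex.sub_im] at h2
    have h3 := abs_sub_abs_le_abs_sub w.im z.im
    have h4 := (abs_le.1 h1).1
    exact ⟨by linarith, by linarith⟩
  have hcm := (continuous_gigPosPDFReal pm ham hbm).measurable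
  have hme := measurable_gigPosExt ap bp pp
  refine differentiableAt_integral_of_dominated (half_pos hz)
    (B := fun u => K * gigPosPDFReal am bm pm u)
    (fun w _ => Measurable.aestronglyMeasurable (by fun_prop)) (fun u w hw => ?_)
    (fun w hw u => ?_) ((integrable_gigPosPDFReal pm ham hbm).const_mul K)
  · rcases lt_or_ge 0 u with hu | hu
    · refine DifferentiableAt.differentiableWithinAt (DifferentiableAt.mul_const ?_ _)
      refine DifferentiableAt.comp w (g := gigPosExt ap bp pp) (f := fun w => w + (u : ℂ))
        (differentiableAt_gigPosExt ap bp pp ?_) (by fun_prop)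
      simp only [Complex.add_re, Complex.ofReal_re]
      linarith [(hball w hw).1]
    · simpa [gigPosPDFReal_of_nonpos am bm pm hu] using differentiableWithinAt_const _
  · refine (h w (hball w hw).1 (hball w hw).2 u).trans
      (mul_le_mul_of_nonneg_right (mul_le_of_le_one_right hK.le (Real.exp_le_one_iff.2 ?_))
        (gigPosPDFReal_nonneg pm ham hbm u))
    nlinarith [(hball w hw).1]

theorem exists_norm_bgigExt_le {ap bp am bm : ℝ} (pp pm : ℝ) (hap : 0 < ap) (hbp : 0 < bp)
    (ham : 0 < am) (hbm : 0 < bm) {r : ℝ} (hr : 0 < r) (M : ℝ) :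
    ∃ K > 0, ∀ z : ℂ, r ≤ z.re → |z.im| ≤ M →
      ‖bgigExt ap bp pp am bm pm z‖ ≤ K * Real.exp (-(ap / 4) * z.re) := by
  obtain ⟨K, hK, h⟩ := exists_norm_gigPosExt_mul_le pp pm hap hbp ham hbm hr M
  have h0 : 0 ≤ ∫ u, gigPosPDFReal am bm pm u :=
    integral_nonneg (gigPosPDFReal_nonneg pm ham hbm)
  refine ⟨K * (∫ u, gigPosPDFReal am bm pm u) + 1, by positivity, fun z hz hM => ?_⟩
  refine (norm_integral_le_of_norm_le ((integrable_gigPosPDFReal pm ham hbm).const_mul _)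
    (ae_of_all _ (h z hz hM))).trans ?_
  rw [integral_const_mul]
  nlinarith [Real.exp_pos (-(ap / 4) * z.re)]

theorem analyticAt_bgigPDFReal_of_pos {ap bp am bm : ℝ} (pp pm : ℝ) (hap : 0 < ap) (hbp : 0 < bp)
    (ham : 0 < am) (hbm : 0 < bm) {x : ℝ} (hx : 0 < x) :
    AnalyticAt ℝ (bgigPDFReal ap bp pp am bm pm) x := by
  have hopen : IsOpen {z : ℂ | 0 < z.re} := isOpen_lt continuous_const Complex.continuous_re
  have h1 : AnalyticAt ℂ (bgigExt ap bp pp am bm pm) (x : ℂ) :=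
    DifferentiableOn.analyticAt (fun z hz => DifferentiableAt.differentiableWithinAt
      (differentiableAt_bgigExt pp pm hap hbp ham hbm hz)) (hopen.mem_nhds (by simpa using hx))
  have h2 : AnalyticAt ℝ (fun y : ℝ => (bgigExt ap bp pp am bm pm y).re) x := by
    have h3 : AnalyticAt ℝ (fun y : ℝ => bgigExt ap bp pp am bm pm y) x :=
      AnalyticAt.comp (g := bgigExt ap bp pp am bm pm) (f := fun y : ℝ => (y : ℂ))
        h1.restrictScalars (Complex.ofRealCLM.analyticAt x)
    exact (Complex.reCLM.analyticAt _).comp h3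
  refine h2.congr ?_
  filter_upwards [Ioi_mem_nhds hx] with y hy
  rw [bgigExt_ofReal ap bp pp am bm pm hy, Complex.ofReal_re]

theorem analyticOnNhd_bgigPDFReal {ap bp am bm : ℝ} (pp pm : ℝ) (hap : 0 < ap) (hbp : 0 < bp)
    (ham : 0 < am) (hbm : 0 < bm) :
    AnalyticOnNhd ℝ (bgigPDFReal ap bp pp am bm pm) {x : ℝ | x ≠ 0} := by
  intro x hx
  rcases lt_or_gt_of_ne hx with hx | hx
  · have h := analyticAt_bgigPDFReal_of_pos pm pp ham hbm hap hbp (neg_pos.2 hx)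
    refine (AnalyticAt.comp (f := fun y : ℝ => -y) h analyticAt_id.neg).congr ?_
    exact Eventually.of_forall fun y => by
      simp only [Function.comp_apply]
      rw [bgigPDFReal_neg]
  · exact analyticAt_bgigPDFReal_of_pos pp pm hap hbp ham hbm hx

/-! ### The characteristic function of the generalized inverse Gaussian distribution -/

theorem charFun_withDensity_ofReal {f : ℝ → ℝ} (hf : Measurable f) (h0 : ∀ x, 0 ≤ f x) (t : ℝ) :
    charFun (volume.withDensity fun x => ENNReal.ofReal (f x)) t =
      ∫ x : ℝ, Complex.exp (t * x * Complex.I) * f x := by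
  rw [charFun_apply_real, integral_withDensity_eq_integral_toReal_smul (by fun_prop)
    (ae_of_all _ fun x => ENNReal.ofReal_lt_top)]
  refine integral_congr_ae (ae_of_all _ fun x => ?_)
  simp only [ENNReal.toReal_ofReal (h0 x), Complex.real_smul, mul_comm]

theorem integral_Ioi_zero_eq_integral_exp (g : ℝ → ℂ) :
    ∫ x in Ioi 0, g x = ∫ v : ℝ, Real.exp v • g (Real.exp v) := by
  have h := integral_image_eq_integral_abs_deriv_smul MeasurableSet.univ
    (fun x _ => (Real.hasDerivAt_exp x).hasDerivWithinAt) Real.exp_injective.injOn g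
  rw [image_univ, Real.range_exp] at h
  simpa [abs_of_pos (Real.exp_pos _)] using h

/-- The characteristic function as an integral over `ℝ`, by the substitution `x = exp v`. -/
theorem charFun_gigPosMeasure {a b : ℝ} (p : ℝ) (ha : 0 < a) (hb : 0 < b) (t : ℝ) :
    charFun (gigPosMeasure a b p) t = gigConst a b p * ∫ v : ℝ,
      Complex.exp (p * v - (((a : ℂ) - 2 * t * Complex.I) * Complex.exp v
        + b * Complex.exp (-v)) / 2) := by
  have hsupp : (∫ x : ℝ, Complex.exp (t * x * Complex.I) * gigPosPDFReal a b p x) =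
      ∫ x in Ioi (0 : ℝ), Complex.exp (t * x * Complex.I) * gigPosPDFReal a b p x := by
    refine (setIntegral_eq_integral_of_forall_compl_eq_zero fun x hx => ?_).symm
    simp [gigPosPDFReal_of_nonpos a b p (not_lt.1 hx)]
  rw [gigPosMeasure, charFun_withDensity_ofReal (continuous_gigPosPDFReal p ha hb).measurable
    (gigPosPDFReal_nonneg p ha hb), hsupp, integral_Ioi_zero_eq_integral_exp, ← integral_const_mul]
  refine integral_congr_ae (ae_of_all _ fun v => ?_)
  have hpow : Real.exp v * Real.exp v ^ (p - 1) = Real.exp (p * v) := by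
    rw [← Real.exp_mul, ← Real.exp_add]
    ring_nf
  have h1 : Real.exp v * gigPosPDFReal a b p (Real.exp v) = gigConst a b p *
      Real.exp (p * v - (a * Real.exp v + b * Real.exp (-v)) / 2) := by
    rw [gigPosPDFReal_of_pos a b p (Real.exp_pos v), sub_eq_add_neg (p * v), Real.exp_add, ← hpow,
      Real.exp_neg v, div_eq_mul_inv b]
    ring
  calc Real.exp v • (Complex.exp (t * (Real.exp v : ℝ) * Complex.I) *
        (gigPosPDFReal a b p (Real.exp v) : ℂ))
      = Complex.exp (t * (Real.exp v : ℝ) * Complex.I) *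
          ((Real.exp v * gigPosPDFReal a b p (Real.exp v) : ℝ) : ℂ) := by
        rw [Complex.real_smul]
        push_cast
        ring
    _ = _ := by
        rw [h1]
        push_cast
        rw [mul_left_comm, ← Complex.exp_add]
        congr 2
        ring

/-- Moving the line of integration to the height at which the two exponentials in the exponent
have the same argument turns the integral into one of Bessel type, with argument `s e^{-iθ}`,
where `s = √(bR)`. -/
theorem norm_integral_cexp_eq {R b θ s : ℝ} (p : ℝ) (hR : 0 < R) (hb : 0 < b) (hθ0 : 0 ≤ θ)
    (hθ : θ < Real.pi / 4) (hs : 0 < s) (hsq : s ^ 2 = b * R) :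
    ‖∫ v : ℝ, Complex.exp (p * v - (R * Complex.exp (-(2 * θ * Complex.I)) * Complex.exp v
        + b * Complex.exp (-v)) / 2)‖ =
      (b / s) ^ p * ‖∫ v : ℝ, Complex.exp (p * v - Complex.exp (-(θ * Complex.I)) * s *
        Real.cosh v)‖ := by
  have hpi := Real.pi_pos
  set E : ℂ → ℂ := fun v => Complex.exp (p * v -
    (R * Complex.exp (-(2 * θ * Complex.I)) * Complex.exp v + b * Complex.exp (-v)) / 2) with hE
  have hκ : 0 < Real.cos (2 * θ) := Real.cos_pos_of_mem_Ioo ⟨by linarith, by linarith⟩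
  have hm : 0 < min R b := lt_min hR hb
  have hshift := integral_eq_integral_add_mul_I_of_bound (F := E) hθ0
    (B := fun x => Real.exp (p * x - min R b * Real.cos (2 * θ) / 2 * x ^ 2))
    (fun z _ => by
      simp only [hE]
      fun_prop)
    (fun x y hy => by
      have h1 : (R * Complex.exp (-(2 * θ * Complex.I)) * Complex.exp (x + y * Complex.I)
          + b * Complex.exp (-(x + y * Complex.I))).re =
          R * (Real.exp x * Real.cos (y - 2 * θ)) + b * (Real.exp (-x) * Real.cos y) := by
        rw [mul_assoc, ← Complex.exp_add]
        simp [Complex.exp_re, neg_add_eq_sub]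
      have h2 : Real.cos (2 * θ) ≤ Real.cos y :=
        Real.cos_le_cos_of_nonneg_of_le_pi hy.1 (by linarith) (by linarith [hy.2])
      have h3 : Real.cos (2 * θ) ≤ Real.cos (y - 2 * θ) := by
        rw [← Real.cos_neg (y - 2 * θ)]
        exact Real.cos_le_cos_of_nonneg_of_le_pi (by linarith [hy.2]) (by linarith)
          (by linarith [hy.1])
      have h4 : min R b * (Real.exp x * Real.cos (2 * θ)) ≤
          R * (Real.exp x * Real.cos (y - 2 * θ)) := by
        gcongr
        exact min_le_left _ _
      have h5 : min R b * (Real.exp (-x) * Real.cos (2 * θ)) ≤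
          b * (Real.exp (-x) * Real.cos y) := by
        gcongr
        exact min_le_right _ _
      have h6 : x ^ 2 / 2 ≤ (Real.exp x + Real.exp (-x)) / 2 := by
        have := Real.one_add_sq_div_two_le_cosh x
        rw [Real.cosh_eq] at this
        linarith
      have h7 := mul_le_mul_of_nonneg_left h6 (mul_pos hm hκ).le
      rw [hE, Complex.norm_exp]
      refine Real.exp_le_exp.2 ?_
      have h8 : ∀ z : ℂ, ((p : ℂ) * (x + y * Complex.I) - z / 2).re = p * x - z.re / 2 := by
        intro z
        simp
      rw [h8, h1]
      nlinarith)
    (integrable_exp_mul_sub_mul_sq p (by positivity))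
    (tendsto_exp_mul_sub_mul_sq_atTop p (by positivity))
    (tendsto_exp_mul_sub_mul_sq_atBot p (by positivity))
  have hbs : 0 < b / s := div_pos hb hs
  have hpt : ∀ v : ℝ, E ((v + Real.log (b / s) : ℝ) + θ * Complex.I) =
      Complex.exp (p * (Real.log (b / s) : ℝ) + p * θ * Complex.I) *
        Complex.exp (p * v - Complex.exp (-(θ * Complex.I)) * s * Real.cosh v) := by
    intro v
    have hl : Complex.exp (Real.log (b / s) : ℝ) = ((b / s : ℝ) : ℂ) := by
      rw [← Complex.ofReal_exp, Real.exp_log hbs]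
    have hRs : (R : ℂ) * ((b / s : ℝ) : ℂ) = s := by
      rw [← Complex.ofReal_mul]
      congr 1
      field_simp
      linarith
    have hbb : (b : ℂ) * ((b / s : ℝ) : ℂ)⁻¹ = s := by
      rw [← Complex.ofReal_inv, ← Complex.ofReal_mul]
      congr 1
      field_simp
    have e1 : (R : ℂ) * Complex.exp (-(2 * θ * Complex.I)) *
        Complex.exp ((v + Real.log (b / s) : ℝ) + θ * Complex.I) =
        s * Complex.exp (-(θ * Complex.I)) * Complex.exp v := by
      rw [Complex.ofReal_add, Complex.exp_add, Complex.exp_add, hl, ← hRs]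
      have : Complex.exp (-(θ * Complex.I)) =
          Complex.exp (-(2 * θ * Complex.I)) * Complex.exp (θ * Complex.I) := by
        rw [← Complex.exp_add]
        ring_nf
      rw [this]
      ring
    have e2 : (b : ℂ) * Complex.exp (-((v + Real.log (b / s) : ℝ) + θ * Complex.I)) =
        s * Complex.exp (-(θ * Complex.I)) * Complex.exp (-v) := by
      rw [Complex.ofReal_add, neg_add, neg_add, Complex.exp_add, Complex.exp_add,
        Complex.exp_neg (Real.log (b / s) : ℝ), hl, ← hbb]
      ring
    simp only [hE]
    rw [e1, e2, ← Complex.exp_add, Complex.ofReal_cosh, Complex.cosh]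
    congr 1
    push_cast
    ring
  have h1 : ∫ v : ℝ, E v = Complex.exp (p * (Real.log (b / s) : ℝ) + p * θ * Complex.I) *
      ∫ v : ℝ, Complex.exp (p * v - Complex.exp (-(θ * Complex.I)) * s * Real.cosh v) := by
    rw [hshift, ← integral_add_right_eq_self _ (Real.log (b / s)), ← integral_const_mul]
    exact integral_congr_ae (ae_of_all _ hpt)
  rw [h1, norm_mul]
  congr 1
  rw [Complex.norm_exp, Real.rpow_def_of_pos hbs]
  congr 1
  rw [← Complex.ofReal_mul, ← Complex.ofReal_mul]
  simp [mul_comm]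

/-- Laplace's method: after the substitution `v = ε y`, with `ε = s^{-1/2}`, the Bessel integral is
a perturbation of a Gaussian one. -/
theorem norm_integral_cexp_cosh_eq {s ε : ℝ} (p : ℝ) (ω : ℂ) (hε : 0 < ε) (hs : s = (ε ^ 2)⁻¹) :
    ‖∫ v : ℝ, Complex.exp (p * v - ω * s * Real.cosh v)‖ =
      ε * Real.exp (-(ω.re * s)) * ‖∫ y : ℝ, Complex.exp
        ((p * (ε * y) : ℝ) - ω * (2 * (ε⁻¹ * Real.sinh (ε * (y / 2))) ^ 2 : ℝ))‖ := by
  have hcosh : ∀ y : ℝ, s * Real.cosh (ε * y) =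
      s + 2 * (ε⁻¹ * Real.sinh (ε * (y / 2))) ^ 2 := by
    intro y
    have h1 := Real.cosh_two_mul (ε * (y / 2))
    rw [Real.cosh_sq, show 2 * (ε * (y / 2)) = ε * y by ring] at h1
    rw [h1, hs]
    field_simp
    ring
  have h1 := Measure.integral_comp_mul_left
    (fun v : ℝ => Complex.exp (p * v - ω * s * Real.cosh v)) ε
  have h2 : ∀ y : ℝ, Complex.exp (p * ((ε * y : ℝ) : ℂ) - ω * s * Real.cosh (ε * y)) =
      Complex.exp (-(ω * s)) * Complex.exp
        ((p * (ε * y) : ℝ) - ω * (2 * (ε⁻¹ * Real.sinh (ε * (y / 2))) ^ 2 : ℝ)) := by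
    intro y
    rw [mul_assoc ω, ← Complex.ofReal_mul s, hcosh, ← Complex.exp_add, Complex.ofReal_add]
    congr 1
    push_cast
    ring
  simp only [h2] at h1
  rw [integral_const_mul] at h1
  have h3 := congrArg norm h1
  rw [norm_mul, norm_smul, Complex.norm_exp, abs_of_pos (inv_pos.2 hε),
    Real.norm_of_nonneg (inv_pos.2 hε).le] at h3
  have h4 : (-(ω * s) : ℂ).re = -(ω.re * s) := by simp
  rw [h4] at h3
  rw [mul_assoc, h3, mul_inv_cancel_left₀ hε.ne']

/-- The convergence to the Gaussian integral: `ε⁻¹ sinh (ε y / 2)` tends to `y / 2`, and dominates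
it in absolute value, which gives an integrable majorant. -/
theorem tendsto_integral_cexp_sinh {ι : Type*} {l : Filter ι} [l.IsCountablyGenerated]
    {ε : ι → ℝ} {ω : ι → ℂ} {ω₀ : ℂ} (p : ℝ) (hε : Tendsto ε l (𝓝[>] 0)) (hω : Tendsto ω l (𝓝 ω₀))
    (hre : ∀ i, 1 / 2 ≤ (ω i).re) :
    Tendsto (fun i => ∫ y : ℝ, Complex.exp
      ((p * (ε i * y) : ℝ) - ω i * (2 * ((ε i)⁻¹ * Real.sinh (ε i * (y / 2))) ^ 2 : ℝ))) l
      (𝓝 (∫ y : ℝ, Complex.exp (-(ω₀ / 2) * y ^ 2))) := by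
  refine tendsto_integral_filter_of_dominated_convergence
    (fun y => Real.exp (p * y - 1 / 4 * y ^ 2) + Real.exp (-p * y - 1 / 4 * y ^ 2))
    (Eventually.of_forall fun i => Continuous.aestronglyMeasurable (by fun_prop)) ?_
    ((integrable_exp_mul_sub_mul_sq p (by norm_num)).add
      (integrable_exp_mul_sub_mul_sq (-p) (by norm_num))) (ae_of_all _ fun y => ?_)
  · have h1 : ∀ᶠ i in l, ε i ∈ Ioc (0 : ℝ) 1 := hε.eventually (Ioc_mem_nhdsGT one_pos)
    filter_upwards [h1] with i hi
    refine ae_of_all _ fun y => ?_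
    have hsq : (y / 2) ^ 2 ≤ ((ε i)⁻¹ * Real.sinh (ε i * (y / 2))) ^ 2 := by
      have h2 : |ε i * (y / 2)| ≤ |Real.sinh (ε i * (y / 2))| := by
        rw [Real.abs_sinh]
        exact Real.self_le_sinh_iff.2 (abs_nonneg _)
      rw [sq_le_sq, abs_mul, abs_inv, abs_of_pos hi.1, inv_mul_eq_div, le_div_iff₀ hi.1]
      rwa [abs_mul, abs_of_pos hi.1, mul_comm] at h2
    have hpy : p * (ε i * y) ≤ |p * y| := by
      calc p * (ε i * y) = ε i * (p * y) := by ring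
        _ ≤ |ε i * (p * y)| := le_abs_self _
        _ = ε i * |p * y| := by rw [abs_mul, abs_of_pos hi.1]
        _ ≤ |p * y| := mul_le_of_le_one_left (abs_nonneg _) hi.2
    have hle : p * (ε i * y) - (ω i).re * (2 * ((ε i)⁻¹ * Real.sinh (ε i * (y / 2))) ^ 2) ≤
        |p * y| - 1 / 4 * y ^ 2 := by
      nlinarith [hre i]
    rw [Complex.norm_exp, Complex.sub_re, Complex.ofReal_re, Complex.re_mul_ofReal]
    refine (Real.exp_le_exp.2 hle).trans ?_
    rcases abs_cases (p * y) with ⟨h, -⟩ | ⟨h, -⟩ <;> rw [h]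
    · linarith [Real.exp_pos (-p * y - 1 / 4 * y ^ 2)]
    · rw [neg_mul]
      linarith [Real.exp_pos (p * y - 1 / 4 * y ^ 2)]
  · have hε0 : Tendsto ε l (𝓝 0) := hε.mono_right nhdsWithin_le_nhds
    have hεne : Tendsto ε l (𝓝[≠] 0) :=
      hε.mono_right (nhdsWithin_mono _ fun x hx => ne_of_gt hx)
    have hder : HasDerivAt (fun e : ℝ => Real.sinh (e * (y / 2))) (y / 2) 0 := by
      have h := (hasDerivAt_mul_const (x := (0 : ℝ)) (y / 2)).sinh
      simpa using h
    have hslope : Tendsto (fun i => (ε i)⁻¹ * Real.sinh (ε i * (y / 2))) l (𝓝 (y / 2)) := by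
      have := (hasDerivAt_iff_tendsto_slope_zero.1 hder).comp hεne
      simpa [Function.comp_def] using this
    have h1 : Tendsto (fun i => p * (ε i * y)) l (𝓝 0) := by
      simpa using (hε0.mul_const y).const_mul p
    have h2 := ((Complex.continuous_ofReal.tendsto _).comp h1).sub
      (hω.mul ((Complex.continuous_ofReal.tendsto _).comp ((hslope.pow 2).const_mul 2)))
    refine (Complex.continuous_exp.tendsto' _ _ ?_).comp h2
    congr 1
    push_cast
    ring

/-- The characteristic function of `GIG₊(a, b, p)` decays only like `exp (-c √t)`, up to powers
of `t`, hence more slowly than any exponential. -/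
theorem tendsto_exp_mul_norm_charFun_gigPosMeasure {a b : ℝ} (p : ℝ) (ha : 0 < a) (hb : 0 < b)
    {δ : ℝ} (hδ : 0 < δ) :
    Tendsto (fun t => Real.exp (δ * t) * ‖charFun (gigPosMeasure a b p) t‖) atTop atTop := by
  have hpi := Real.pi_pos
  set A : ℝ → ℂ := fun t => (a : ℂ) - 2 * t * Complex.I with hA
  have hAre : ∀ t, (A t).re = a := fun t => by simp [hA]
  have hAim : ∀ t, (A t).im = -(2 * t) := fun t => by simp [hA]
  set R : ℝ → ℝ := fun t => ‖A t‖ with hRdef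
  have hAR : ∀ t, a ≤ R t := fun t => (hAre t).symm.le.trans (Complex.re_le_norm _)
  have hR : ∀ t, 0 < R t := fun t => ha.trans_le (hAR t)
  set θ : ℝ → ℝ := fun t => -(A t).arg / 2 with hθdef
  set s : ℝ → ℝ := fun t => Real.sqrt (b * R t) with hsdef
  have hs : ∀ t, 0 < s t := fun t => Real.sqrt_pos.2 (mul_pos hb (hR t))
  have hsq : ∀ t, s t ^ 2 = b * R t := fun t => Real.sq_sqrt (mul_pos hb (hR t)).le
  set ε : ℝ → ℝ := fun t => (Real.sqrt (s t))⁻¹ with hεdef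
  have hε : ∀ t, 0 < ε t := fun t => inv_pos.2 (Real.sqrt_pos.2 (hs t))
  have hsε : ∀ t, s t = (ε t ^ 2)⁻¹ := fun t => by
    rw [hεdef, inv_pow, Real.sq_sqrt (hs t).le, inv_inv]
  set ω : ℝ → ℂ := fun t => Complex.exp (-(θ t * Complex.I)) with hωdef
  have hωre : ∀ t, (ω t).re = Real.cos (θ t) := fun t => by
    simp [hωdef, Complex.exp_re]
  have hθabs : ∀ t, |θ t| < Real.pi / 4 := fun t => by
    have h := Complex.abs_arg_lt_pi_div_two_iff.2 (Or.inl (by rw [hAre]; exact ha : 0 < (A t).re))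
    rw [hθdef, abs_div, abs_neg, abs_two]
    linarith
  have hωhalf : ∀ t, 1 / 2 ≤ (ω t).re := fun t => by
    rw [hωre, ← Real.cos_abs, ← Real.cos_pi_div_three]
    exact Real.cos_le_cos_of_nonneg_of_le_pi (abs_nonneg _) (by linarith)
      (by linarith [hθabs t])
  have hωle : ∀ t, (ω t).re ≤ 1 := fun t => by
    rw [hωre]
    exact Real.cos_le_one _
  -- as `t → ∞`, the modulus of `a - 2 i t` tends to infinity and its argument to `-π / 2`
  have hRtop : Tendsto R atTop atTop := by
    refine tendsto_atTop_mono' atTop (f₁ := fun t => t) ?_ tendsto_id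
    filter_upwards [eventually_ge_atTop 0] with t ht
    have := Complex.abs_im_le_norm (A t)
    rw [hAim, abs_neg, abs_of_nonneg (by linarith)] at this
    change t ≤ ‖A t‖
    linarith
  have hs_lim : Tendsto s atTop atTop :=
    Real.tendsto_sqrt_atTop.comp (hRtop.const_mul_atTop hb)
  have hεlim : Tendsto ε atTop (𝓝[>] 0) :=
    tendsto_inv_atTop_nhdsGT_zero.comp (Real.tendsto_sqrt_atTop.comp hs_lim)
  have hθlim : Tendsto θ atTop (𝓝 (Real.pi / 4)) := by
    have h1 : Tendsto (fun t : ℝ => ((a * t⁻¹ : ℝ) : ℂ) - 2 * Complex.I) atTop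
        (𝓝 (-(2 * Complex.I))) := by
      have h2 := (Complex.continuous_ofReal.tendsto _).comp
        ((tendsto_inv_atTop_zero (𝕜 := ℝ)).const_mul a)
      simpa using h2.sub_const (2 * Complex.I)
    have h2 : (-(2 * Complex.I)) ∈ Complex.slitPlane := Or.inr (by simp)
    have h3 : Complex.arg (-(2 * Complex.I)) = -(Real.pi / 2) := by
      rw [← mul_neg]
      have := Complex.arg_real_mul (-Complex.I) (r := 2) two_pos
      rw [Complex.ofReal_ofNat] at this
      rw [this, Complex.arg_neg_I]
    have h4 := ((Complex.continuousAt_arg h2).tendsto.comp h1)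
    rw [h3] at h4
    have h5 : Tendsto (fun t => (A t).arg) atTop (𝓝 (-(Real.pi / 2))) := by
      refine h4.congr' ?_
      filter_upwards [eventually_gt_atTop 0] with t ht
      have h6 : A t = t * (((a * t⁻¹ : ℝ) : ℂ) - 2 * Complex.I) := by
        have : (t : ℂ) ≠ 0 := Complex.ofReal_ne_zero.2 ht.ne'
        simp only [hA]
        push_cast
        field_simp
      rw [h6, Complex.arg_real_mul _ ht]
      rfl
    have h6 := h5.neg.div_const 2
    have h7 : -(-(Real.pi / 2)) / 2 = Real.pi / 4 := by ring
    rwa [h7] at h6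
  have hωlim : Tendsto ω atTop (𝓝 (Complex.exp (-((Real.pi / 4 : ℝ) * Complex.I)))) := by
    have hcont : Continuous fun x : ℝ => Complex.exp (-(x * Complex.I)) := by fun_prop
    exact (hcont.tendsto _).comp hθlim
  set ω₀ : ℂ := Complex.exp (-((Real.pi / 4 : ℝ) * Complex.I)) with hω₀
  have hω₀re : 0 < (ω₀ / 2).re := by
    have h1 : 1 / 2 ≤ ω₀.re := ge_of_tendsto ((Complex.continuous_re.tendsto _).comp hωlim)
      (Eventually.of_forall hωhalf)
    have h2 : (ω₀ / 2).re = ω₀.re / 2 := by simp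
    rw [h2]
    linarith
  have hQ := (tendsto_integral_cexp_sinh p hεlim hωlim hωhalf).norm
  set Q : ℝ → ℝ := fun t => ‖∫ y : ℝ, Complex.exp ((p * (ε t * y) : ℝ) -
    ω t * (2 * ((ε t)⁻¹ * Real.sinh (ε t * (y / 2))) ^ 2 : ℝ))‖ with hQdef
  have hlimpos : 0 < ‖∫ y : ℝ, Complex.exp (-(ω₀ / 2) * y ^ 2)‖ := by
    rw [integral_gaussian_complex hω₀re, norm_pos_iff, Complex.cpow_ne_zero_iff]
    left
    refine div_ne_zero (Complex.ofReal_ne_zero.2 hpi.ne') ?_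
    intro h
    rw [h] at hω₀re
    simp at hω₀re
  have hchar : ∀ t, 0 ≤ t → ‖charFun (gigPosMeasure a b p) t‖ =
      gigConst a b p * ((b / s t) ^ p * (ε t * Real.exp (-((ω t).re * s t)) * Q t)) := by
    intro t ht
    have hAexp : A t = R t * Complex.exp (-(2 * θ t * Complex.I)) := by
      conv_lhs => rw [← Complex.norm_mul_exp_arg_mul_I (A t)]
      rw [hθdef]
      congr 2
      push_cast
      ring
    have hθ0 : 0 ≤ θ t := by
      have h : (A t).arg ≤ 0 := by
        rcases ht.eq_or_lt with rfl | ht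
        · simp only [hA, Complex.ofReal_zero, mul_zero, zero_mul, sub_zero]
          rw [Complex.arg_ofReal_of_nonneg ha.le]
        · exact (Complex.arg_neg_iff.2 (by rw [hAim]; linarith)).le
      rw [hθdef]
      change 0 ≤ -(A t).arg / 2
      linarith
    rw [charFun_gigPosMeasure p ha hb, norm_mul, Complex.norm_real,
      Real.norm_of_nonneg (gigConst_pos p ha hb).le]
    congr 1
    have h1 := norm_integral_cexp_eq p (hR t) hb hθ0 ((le_abs_self _).trans_lt (hθabs t)) (hs t)
      (hsq t)
    rw [← hAexp] at h1
    rw [h1]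
    congr 1
    exact norm_integral_cexp_cosh_eq p (ω t) (hε t) (hsε t)
  have hgrow : Tendsto (fun t => gigConst a b p * b ^ p * Real.exp (-(δ * a / 2)) *
      (Real.exp (s t) / s t ^ (p + 1 / 2) * Q t)) atTop atTop := by
    refine Tendsto.const_mul_atTop ?_
      (((tendsto_exp_div_rpow_atTop _).comp hs_lim).atTop_mul_pos hlimpos hQ)
    have := gigConst_pos p ha hb
    positivity
  refine tendsto_atTop_mono' atTop ?_ hgrow
  filter_upwards [eventually_ge_atTop 0, hs_lim.eventually_ge_atTop (4 * b / δ)] with t ht hst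
  have hc := gigConst_pos p ha hb
  have hspos := hs t
  have hQ0 : 0 ≤ Q t := norm_nonneg _
  have hεs : ε t = s t ^ (-(1 / 2) : ℝ) := by
    rw [hεdef, Real.rpow_neg hspos.le, ← Real.sqrt_eq_rpow]
  have hpow : (b / s t) ^ p * ε t = b ^ p / s t ^ (p + 1 / 2) := by
    rw [hεs, Real.div_rpow hb.le hspos.le, Real.rpow_add hspos, Real.rpow_neg hspos.le]
    field_simp
  -- since `s ^ 2 = b R ≤ b (a + 2 t)`, the factor `exp (δ t)` beats `exp (-s)`
  have hRle : R t ≤ a + 2 * t := by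
    have := Complex.norm_le_abs_re_add_abs_im (A t)
    rwa [hAre, hAim, abs_neg, abs_of_pos ha, abs_of_nonneg (by linarith)] at this
  have hexp : s t - δ * a / 2 ≤ δ * t - (ω t).re * s t := by
    have h1 : (ω t).re * s t ≤ s t := mul_le_of_le_one_left hspos.le (hωle t)
    have h2 : 4 * b ≤ s t * δ := (div_le_iff₀ hδ).1 hst
    have h3 : 4 * b * s t ≤ δ * (b * R t) := by
      rw [← hsq t]
      nlinarith
    have h4 : 4 * s t ≤ δ * R t := by
      refine le_of_mul_le_mul_left ?_ hb
      linarith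
    have h5 : δ * R t ≤ δ * (a + 2 * t) := mul_le_mul_of_nonneg_left hRle hδ.le
    linarith
  calc gigConst a b p * b ^ p * Real.exp (-(δ * a / 2)) *
        (Real.exp (s t) / s t ^ (p + 1 / 2) * Q t)
      = gigConst a b p * (b ^ p / s t ^ (p + 1 / 2)) * Q t * Real.exp (s t - δ * a / 2) := by
        rw [sub_eq_add_neg, Real.exp_add]
        ring
    _ ≤ gigConst a b p * (b ^ p / s t ^ (p + 1 / 2)) * Q t *
        Real.exp (δ * t - (ω t).re * s t) := by
        gcongr
    _ = Real.exp (δ * t) * ‖charFun (gigPosMeasure a b p) t‖ := by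
        rw [hchar t ht, ← hpow, sub_eq_add_neg, Real.exp_add]
        ring

/-! ### Failure of analyticity at the origin -/

theorem integrable_exp_neg_mul_abs {d : ℝ} (hd : 0 < d) :
    Integrable fun x : ℝ => Real.exp (-d * |x|) := by
  have h : IntegrableOn (fun x : ℝ => Real.exp (-d * |x|)) (Ioi 0) := by
    refine (exp_neg_integrableOn_Ioi 0 hd).congr_fun (fun x hx => ?_) measurableSet_Ioi
    rw [abs_of_pos hx]
  have h' : IntegrableOn (fun x : ℝ => Real.exp (-d * |x|)) (Iic 0) := by
    rw [integrableOn_Iic_iff_integrableOn_Iio]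
    have h1 : IntegrableOn (fun x : ℝ => Real.exp (-d * |-x|)) (Iio 0) :=
      IntegrableOn.comp_neg_Iio (f := fun x : ℝ => Real.exp (-d * |x|)) (by rwa [neg_zero])
    simpa only [abs_neg] using h1
  rw [← integrableOn_univ, ← Iic_union_Ioi (a := (0 : ℝ))]
  exact h'.union h

/-- The identity theorem for two holomorphic functions that agree on a real interval. -/
theorem eqOn_of_eventually_eq_ofReal {g h : ℂ → ℂ} {U : Set ℂ} (hU : IsOpen U)
    (hUc : IsPreconnected U) (hg : DifferentiableOn ℂ g U) (hh : DifferentiableOn ℂ h U) {x₀ : ℝ}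
    (hx₀ : (x₀ : ℂ) ∈ U) (heq : ∀ᶠ x : ℝ in 𝓝 x₀, g x = h x) : EqOn g h U := by
  refine (hg.analyticOnNhd hU).eqOn_of_preconnected_of_frequently_eq (hh.analyticOnNhd hU) hUc
    hx₀ ?_
  have ht : Tendsto (fun x : ℝ => (x : ℂ)) (𝓝[≠] x₀) (𝓝[≠] (x₀ : ℂ)) :=
    tendsto_nhdsWithin_iff.2 ⟨(Complex.continuous_ofReal.tendsto x₀).mono_left nhdsWithin_le_nhds,
      eventually_nhdsWithin_of_forall fun x hx => by simpa using hx⟩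
  exact ht.frequently (heq.filter_mono nhdsWithin_le_nhds).frequently

/-- If the bilateral density were analytic at the origin, its extensions to the two half-planes
and the sum of its Taylor series would fit together to a holomorphic function on a horizontal
strip, with exponential decay in the real direction. -/
theorem AnalyticAt.exists_bgig_strip_extension {ap bp am bm : ℝ} {pp pm : ℝ} (hap : 0 < ap)
    (hbp : 0 < bp) (ham : 0 < am) (hbm : 0 < bm)
    (h : AnalyticAt ℝ (bgigPDFReal ap bp pp am bm pm) 0) :
    ∃ F : ℂ → ℂ, ∃ c > 0, ∃ K, ∃ d > 0, (∀ x : ℝ, F x = bgigPDFReal ap bp pp am bm pm x) ∧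
      (∀ z : ℂ, z.im ∈ Icc 0 c → DifferentiableAt ℂ F z) ∧
      ∀ x : ℝ, ∀ y ∈ Icc 0 c, ‖F (x + y * Complex.I)‖ ≤ K * Real.exp (-d * |x|) := by
  obtain ⟨r, hr, G, hG, hGf⟩ := h.exists_complexification
  set Fp := bgigExt ap bp pp am bm pm with hFp
  set Fm : ℂ → ℂ := fun z => bgigExt am bm pm ap bp pp (-z) with hFm
  have hFpd : ∀ z : ℂ, 0 < z.re → DifferentiableAt ℂ Fp z := fun z hz =>
    differentiableAt_bgigExt pp pm hap hbp ham hbm hz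
  have hFmd : ∀ z : ℂ, z.re < 0 → DifferentiableAt ℂ Fm z := fun z hz =>
    DifferentiableAt.comp z (g := bgigExt am bm pm ap bp pp) (f := fun z => -z)
      (differentiableAt_bgigExt pm pp ham hbm hap hbp (by simpa using hz))
      differentiableAt_id.neg
  have hFpf : ∀ x : ℝ, 0 < x → Fp x = bgigPDFReal ap bp pp am bm pm x := fun x hx =>
    bgigExt_ofReal ap bp pp am bm pm hx
  have hFmf : ∀ x : ℝ, x < 0 → Fm x = bgigPDFReal ap bp pp am bm pm x := fun x hx => by
    have h1 := bgigExt_ofReal am bm pm ap bp pp (neg_pos.2 hx)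
    rw [bgigPDFReal_neg, Complex.ofReal_neg] at h1
    exact h1
  have hop : IsOpen {z : ℂ | 0 < z.re} := isOpen_lt continuous_const Complex.continuous_re
  have hom : IsOpen {z : ℂ | z.re < 0} := isOpen_lt Complex.continuous_re continuous_const
  have hmem : ∀ x : ℝ, |x| < r → (x : ℂ) ∈ Metric.ball (0 : ℂ) r := fun x hx => by simpa using hx
  have habs : ∀ x : ℝ, |x| < r → ∀ᶠ y : ℝ in 𝓝 x, |y| < r := fun x hx =>
    continuous_abs.continuousAt.eventually_lt_const hx
  have hr2 : |r / 2| < r := by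
    rw [abs_of_pos (half_pos hr)]
    exact half_lt_self hr
  have hGp : EqOn Fp G (Metric.ball 0 r ∩ {z : ℂ | 0 < z.re}) := by
    refine eqOn_of_eventually_eq_ofReal (Metric.isOpen_ball.inter hop)
      ((convex_ball _ _).inter (convex_halfSpace_re_gt 0)).isPreconnected
      (fun z hz => (hFpd z hz.2).differentiableWithinAt) (hG.mono inter_subset_left) (x₀ := r / 2)
      ⟨hmem _ hr2, by simpa using half_pos hr⟩ ?_
    filter_upwards [habs _ hr2, Ioi_mem_nhds (half_pos hr)] with y hy hy0
    rw [hGf y hy, hFpf y hy0]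
  have hGm : EqOn Fm G (Metric.ball 0 r ∩ {z : ℂ | z.re < 0}) := by
    have hr2' : |-(r / 2)| < r := by rwa [abs_neg]
    refine eqOn_of_eventually_eq_ofReal (Metric.isOpen_ball.inter hom)
      ((convex_ball _ _).inter (convex_halfSpace_re_lt 0)).isPreconnected
      (fun z hz => (hFmd z hz.2).differentiableWithinAt) (hG.mono inter_subset_left)
      (x₀ := -(r / 2))
      ⟨hmem _ hr2', by simpa using hr⟩ ?_
    filter_upwards [habs _ hr2', Iio_mem_nhds (neg_lt_zero.2 (half_pos hr))] with y hy hy0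
    rw [hGf y hy, hFmf y hy0]
  set F : ℂ → ℂ := fun z => if 0 < z.re then Fp z else if z.re < 0 then Fm z else G z with hF
  have hF_pos : ∀ z : ℂ, 0 < z.re → F z = Fp z := fun z hz => by simp only [hF, if_pos hz]
  have hF_neg : ∀ z : ℂ, z.re < 0 → F z = Fm z := fun z hz => by
    simp only [hF, if_neg hz.not_gt, if_pos hz]
  have hF_ball : EqOn F G (Metric.ball 0 r) := fun z hz => by
    rcases lt_trichotomy z.re 0 with h0 | h0 | h0
    · rw [hF_neg z h0, hGm ⟨hz, h0⟩]
    · simp only [hF, h0, lt_irrefl, if_false]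
    · rw [hF_pos z h0, hGp ⟨hz, h0⟩]
  have hc : 0 < r / 3 := by positivity
  -- the square of half-side `r / 3` lies in the disc of radius `r`, so the strip of height `r / 3`
  -- is covered by the disc and the two half-planes
  have hball : ∀ z : ℂ, |z.re| ≤ r / 3 → |z.im| ≤ r / 3 → z ∈ Metric.ball (0 : ℂ) r :=
    fun z h1 h2 => by
      rw [mem_ball_zero_iff]
      linarith [Complex.norm_le_abs_re_add_abs_im z]
  obtain ⟨K₁, hK₁, h₁⟩ := exists_norm_bgigExt_le pp pm hap hbp ham hbm hc (r / 3)
  obtain ⟨K₂, hK₂, h₂⟩ := exists_norm_bgigExt_le pm pp ham hbm hap hbp hc (r / 3)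
  obtain ⟨K₃, h₃⟩ := ((isCompact_Icc (a := -(r / 3)) (b := r / 3)).reProdIm
    (isCompact_Icc (a := -(r / 3)) (b := r / 3))).exists_bound_of_continuousOn
    (hG.continuousOn.mono fun z hz => hball z (abs_le.2 hz.1) (abs_le.2 hz.2))
  have hK₃ : 0 ≤ K₃ := (norm_nonneg _).trans (h₃ 0 (by
    constructor <;> simp [hc.le]))
  set d : ℝ := min ap am / 4 with hd
  have hd0 : 0 < d := by
    have := lt_min hap ham
    positivity
  refine ⟨F, r / 3, hc, K₁ + K₂ + K₃ * Real.exp (d * (r / 3)), d, hd0, fun x => ?_,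
    fun z hz => ?_, fun x y hy => ?_⟩
  · rcases lt_trichotomy x 0 with h0 | rfl | h0
    · rw [hF_neg _ (by simpa using h0), hFmf x h0]
    · rw [hF_ball (by simpa using hr), hGf 0 (by simpa using hr)]
    · rw [hF_pos _ (by simpa using h0), hFpf x h0]
  · rcases lt_trichotomy z.re 0 with h0 | h0 | h0
    · refine (hFmd z h0).congr_of_eventuallyEq ?_
      filter_upwards [hom.mem_nhds h0] with w hw using hF_neg w hw
    · have hzb : z ∈ Metric.ball (0 : ℂ) r := hball z (by rw [h0, abs_zero]; exact hc.le)
        (by rw [abs_of_nonneg hz.1]; exact hz.2)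
      have hnhds := Metric.isOpen_ball.mem_nhds hzb
      refine (hG.differentiableAt hnhds).congr_of_eventuallyEq ?_
      filter_upwards [hnhds] with w hw using hF_ball hw
    · refine (hFpd z h0).congr_of_eventuallyEq ?_
      filter_upwards [hop.mem_nhds h0] with w hw using hF_pos w hw
  · have hre : (x + y * Complex.I : ℂ).re = x := by simp
    have him : (x + y * Complex.I : ℂ).im = y := by simp
    have hyabs : |y| ≤ r / 3 := by
      rw [abs_of_nonneg hy.1]
      exact hy.2
    have hexp := Real.exp_pos (-d * |x|)
    have hexp' := Real.exp_pos (d * (r / 3))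
    have hle : ∀ k ≤ K₁ + K₂ + K₃ * Real.exp (d * (r / 3)),
        k * Real.exp (-d * |x|) ≤
          (K₁ + K₂ + K₃ * Real.exp (d * (r / 3))) * Real.exp (-d * |x|) :=
      fun k hk => mul_le_mul_of_nonneg_right hk hexp.le
    have hda : d ≤ ap / 4 := by
      have := min_le_left ap am
      linarith
    have hdm : d ≤ am / 4 := by
      have := min_le_right ap am
      linarith
    rcases le_or_gt (r / 3) x with hx | hx
    · have hx0 : 0 < x := hc.trans_le hx
      rw [hF_pos _ (by rwa [hre])]
      refine (h₁ _ (by rwa [hre]) (by rwa [him])).trans (le_trans ?_ (hle K₁ ?_))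
      · rw [hre, abs_of_pos hx0]
        refine mul_le_mul_of_nonneg_left (Real.exp_le_exp.2 ?_) hK₁.le
        nlinarith
      · nlinarith [mul_nonneg hK₃ hexp'.le]
    · rcases le_or_gt x (-(r / 3)) with hx' | hx'
      · have hx0 : x < 0 := by linarith
        rw [hF_neg _ (by rwa [hre])]
        refine (h₂ _ (by rw [Complex.neg_re, hre]; linarith)
          (by rwa [Complex.neg_im, him, abs_neg])).trans (le_trans ?_ (hle K₂ ?_))
        · rw [Complex.neg_re, hre, abs_of_neg hx0]
          refine mul_le_mul_of_nonneg_left (Real.exp_le_exp.2 ?_) hK₂.le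
          nlinarith
        · nlinarith [mul_nonneg hK₃ hexp'.le]
      · have hxabs : |x| ≤ r / 3 := abs_le.2 ⟨hx'.le, hx.le⟩
        rw [hF_ball (hball _ (by rwa [hre]) (by rwa [him]))]
        refine (h₃ _ ⟨?_, ?_⟩).trans
          (le_trans ?_ (hle (K₃ * Real.exp (d * (r / 3))) (by linarith)))
        · rw [mem_preimage, hre]
          exact abs_le.1 hxabs
        · rw [mem_preimage, him]
          exact abs_le.1 hyabs
        · rw [mul_assoc, ← Real.exp_add]
          refine le_mul_of_one_le_right hK₃ (Real.one_le_exp ?_)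
          nlinarith

/-- Moving the contour up by the height `c` of the strip gains the factor `exp (-c t)`. -/
theorem AnalyticAt.exists_norm_charFun_bgigMeasure_le {ap bp am bm : ℝ} {pp pm : ℝ} (hap : 0 < ap)
    (hbp : 0 < bp) (ham : 0 < am) (hbm : 0 < bm)
    (h : AnalyticAt ℝ (bgigPDFReal ap bp pp am bm pm) 0) :
    ∃ c > 0, ∃ C, ∀ t, 0 ≤ t →
      ‖charFun (bgigMeasure ap bp pp am bm pm) t‖ ≤ C * Real.exp (-(c * t)) := by
  obtain ⟨F, c, hc, K, d, hd, hFf, hFd, hFb⟩ := h.exists_bgig_strip_extension hap hbp ham hbm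
  have hBi : Integrable fun x : ℝ => K * Real.exp (-d * |x|) :=
    (integrable_exp_neg_mul_abs hd).const_mul K
  have hlim : ∀ {l : Filter ℝ}, Tendsto (fun x : ℝ => |x|) l atTop →
      Tendsto (fun x : ℝ => K * Real.exp (-d * |x|)) l (𝓝 0) := fun hl => by
    have h1 := (Real.tendsto_exp_atBot.comp
      (hl.const_mul_atTop_of_neg (neg_lt_zero.2 hd))).const_mul K
    rwa [mul_zero] at h1
  refine ⟨c, hc, ∫ x : ℝ, K * Real.exp (-d * |x|), fun t ht => ?_⟩
  have hnorm : ∀ x y : ℝ, ‖Complex.exp (t * (x + y * Complex.I) * Complex.I)‖ =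
      Real.exp (-(y * t)) := fun x y => by
    rw [Complex.norm_exp]
    congr 1
    simp [mul_comm]
  have hshift := integral_eq_integral_add_mul_I_of_bound
    (F := fun z => Complex.exp (t * z * Complex.I) * F z) hc.le
    (fun z hz => DifferentiableAt.mul (by fun_prop) (hFd z hz))
    (fun x y hy => by
      rw [norm_mul, hnorm]
      refine (mul_le_of_le_one_left (norm_nonneg _) ?_).trans (hFb x y hy)
      exact Real.exp_le_one_iff.2 (neg_nonpos.2 (mul_nonneg hy.1 ht)))
    hBi (hlim tendsto_abs_atTop_atTop) (hlim tendsto_abs_atBot_atTop)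
  simp only [hFf] at hshift
  rw [bgigMeasure_eq_withDensity pp pm hap hbp ham hbm, charFun_withDensity_ofReal
    (continuous_bgigPDFReal pp pm hap hbp ham hbm).measurable
    (bgigPDFReal_nonneg pp pm hap hbp ham hbm), hshift]
  refine (norm_integral_le_of_norm_le (hBi.mul_const (Real.exp (-(c * t))))
    (ae_of_all _ fun x => ?_)).trans_eq (integral_mul_const _ _)
  rw [norm_mul, hnorm, mul_comm]
  exact mul_le_mul_of_nonneg_right (hFb x c ⟨hc.le, le_rfl⟩) (Real.exp_pos _).le

theorem norm_charFun_gigNegMeasure {a b : ℝ} (p : ℝ) (ha : 0 < a) (hb : 0 < b) (t : ℝ) :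
    ‖charFun (gigNegMeasure a b p) t‖ = ‖charFun (gigPosMeasure a b p) t‖ := by
  have h1 : charFun (gigNegMeasure a b p) t = charFun (gigPosMeasure a b p) (-t) := by
    have hm := (continuous_gigPosPDFReal p ha hb).measurable
    have h0 := gigPosPDFReal_nonneg p ha hb
    rw [gigNegMeasure, gigPosMeasure, charFun_withDensity_ofReal hm h0]
    simp only [gigNegPDFReal_eq]
    rw [charFun_withDensity_ofReal (f := fun x => gigPosPDFReal a b p (-x))
      (hm.comp measurable_neg) (fun x => h0 (-x)),
      ← integral_neg_eq_self]
    simp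
  rw [h1, charFun_neg, RCLike.norm_conj]

theorem not_analyticAt_bgigPDFReal_zero {ap bp am bm : ℝ} (pp pm : ℝ) (hap : 0 < ap)
    (hbp : 0 < bp) (ham : 0 < am) (hbm : 0 < bm) :
    ¬ AnalyticAt ℝ (bgigPDFReal ap bp pp am bm pm) 0 := by
  intro h
  obtain ⟨c, hc, C, hC⟩ := h.exists_norm_charFun_bgigMeasure_le hap hbp ham hbm
  have hfin₁ : IsFiniteMeasure (gigPosMeasure ap bp pp) :=
    isFiniteMeasure_withDensity_ofReal (integrable_gigPosPDFReal pp hap hbp).2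
  have hfin₂ : IsFiniteMeasure (gigNegMeasure am bm pm) := by
    refine isFiniteMeasure_withDensity_ofReal ?_
    rw [funext (gigNegPDFReal_eq am bm pm)]
    exact (integrable_gigPosPDFReal pm ham hbm).comp_neg.2
  -- half of the exponential factor is spent on each of the two laws
  have hlim :=
    (tendsto_exp_mul_norm_charFun_gigPosMeasure pp hap hbp (half_pos hc)).atTop_mul_atTop₀
    (tendsto_exp_mul_norm_charFun_gigPosMeasure pm ham hbm (half_pos hc))
  obtain ⟨t, ht, ht0⟩ := ((hlim.eventually_gt_atTop C).and (eventually_ge_atTop 0)).exists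
  refine ht.not_ge ?_
  have h1 := hC t ht0
  rw [bgigMeasure, charFun_conv, norm_mul, norm_charFun_gigNegMeasure pm ham hbm, Real.exp_neg,
    ← div_eq_mul_inv, le_div_iff₀ (Real.exp_pos _)] at h1
  refine le_trans (le_of_eq ?_) h1
  have h2 : c * t = c / 2 * t + c / 2 * t := by ring
  rw [h2, Real.exp_add]
  ring

theorem mainTheorem2 (ap bp pp am bm pm : ℝ)
    (hap : 0 < ap) (hbp : 0 < bp) (ham : 0 < am) (hbm : 0 < bm) :
    -- the function is the continuous density of the distribution
    (bgigMeasure ap bp pp am bm pm =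
        volume.withDensity (fun x => ENNReal.ofReal (bgigPDFReal ap bp pp am bm pm x)) ∧
      Continuous (bgigPDFReal ap bp pp am bm pm)) ∧
    ¬ AnalyticAt ℝ (bgigPDFReal ap bp pp am bm pm) 0 ∧
    AnalyticOnNhd ℝ (bgigPDFReal ap bp pp am bm pm) {x : ℝ | x ≠ 0} :=
  ⟨⟨bgigMeasure_eq_withDensity pp pm hap hbp ham hbm,
    continuous_bgigPDFReal pp pm hap hbp ham hbm⟩,
    not_analyticAt_bgigPDFReal_zero pp pm hap hbp ham hbm,
    analyticOnNhd_bgigPDFReal pp pm hap hbp ham hbm⟩
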